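/- A parking function of size $n$ is a function $\pi:\{1,\dots,n\}\to\{1,\dots,n\}$ whose nondecreasing rearrangement $\pi'(1)\le\dots\le\pi'(n)$ satisfies $\pi'(i)\le i$ for all $i$. For every $n\ge 1$ let $\pi_n$ be a random parking function of size $n$, chosen uniformly among all parking functions of size $n$, and let $(k_n)$ be a sequence of integers with $1\le k_n\le n$ for all sufficiently large $n$ and $k_n\to\infty$. (i) If $k_n=o(\sqrt n)$, then $$\sqrt{\frac{12}{k_n}}\left(\frac{\pi_n(1)+\dots+\pi_n(k_n)}{n}-\frac{k_n}{2}\right)\longrightarrow\mathcal N(0,1)$$ in distribution as $n\to\infty$, where $\mathcal N(0,1)$ is the standard normal distribution. (ii) If $k_n=o(n)$, then $$k_n\left(1-\frac1n\max\{\pi_n(1),\dots,\pi_n(k_n)\}\right)\longrightarrow\mathcal E(1)$$ in distribution as $n\to\infty$, where $\mathcal E(1)$ is the exponential distribution with mean $1$. -/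

import Mathlib

open MeasureTheory ProbabilityTheory Filter Asymptotics

/-- A parking function of size `n`. The positions `1, …, n` and the values `1, …, n` are encoded by
`Fin n` via `i ↦ i + 1`, both shifted by one; `f ∘ Tuple.sort f` is the nondecreasing rearrangement
`π'` of `f`, and the condition says `π' i ≤ i` for every `i`. -/
def IsParkingFunction {n : ℕ} (f : Fin n → Fin n) : Prop :=
  ∀ i : Fin n, (f ∘ Tuple.sort f) i ≤ i

/-- The uniform probability measure on the parking functions of size `n`. -/
noncomputable def uniformParking (n : ℕ) : Measure (Fin n → Fin n) :=
  uniformOn {f | IsParkingFunction f}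

/-- The value `π(i) ∈ {1, …, n}` of the function encoded by `f`. -/
def place {n : ℕ} (f : Fin n → Fin n) (i : Fin n) : ℕ := (f i : ℕ) + 1

/-- `π(1) + … + π(k)`, for `k ≤ n`. -/
def sumFirst {n : ℕ} (k : ℕ) (f : Fin n → Fin n) : ℕ :=
  ∑ i ∈ Finset.univ.filter (fun i : Fin n => (i : ℕ) < k), place f i

/-- `max {π(1), …, π(k)}`, for `1 ≤ k ≤ n`. -/
def maxFirst {n : ℕ} (k : ℕ) (f : Fin n → Fin n) : ℕ :=
  (Finset.univ.filter fun i : Fin n => (i : ℕ) < k).sup (place f)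

instance isProbabilityMeasure_expMeasure_one : IsProbabilityMeasure (expMeasure 1) :=
  isProbabilityMeasure_expMeasure one_pos

section Combinatorics

open Finset
open scoped Classical

/-- The parking condition for preferences `f` of cars indexed by `ι`, spots being counted from
`0`. -/
def IsParking {ι : Type*} [Fintype ι] (f : ι → ℕ) : Prop :=
  ∀ j ≤ Fintype.card ι, j ≤ #{i | f i < j}

theorem IsParking.lt_card {ι : Type*} [Fintype ι] {f : ι → ℕ} (hf : IsParking f) (i : ι) :
    f i < Fintype.card ι := by
  have h : #{i | f i < Fintype.card ι} = #(univ : Finset ι) :=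
    le_antisymm (card_le_card (filter_subset _ _)) (hf _ le_rfl)
  exact (card_filter_eq_iff.1 h) i (mem_univ i)

theorem isParkingFunction_iff {n : ℕ} (f : Fin n → Fin n) :
    IsParkingFunction f ↔ IsParking fun i => (f i : ℕ) := by
  have key (i : Fin n) : (f ∘ ⇑(Tuple.sort f)) i ≤ i ↔ (i : ℕ) + 1 ≤ #{j : Fin n | (f j : ℕ) < i + 1} := by
    rw [← Tuple.lt_card_le_iff_apply_le_of_monotone (Tuple.monotone_sort f)]
    have : #{j | (f ∘ ⇑(Tuple.sort f)) j ≤ i} = #{j : Fin n | (f j : ℕ) < i + 1} :=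
      card_bij (fun j _ => Tuple.sort f j)
        (by simp only [mem_filter_univ, Function.comp_apply, Fin.le_iff_val_le_val,
          Nat.lt_succ_iff, imp_self, implies_true])
        (fun _ _ _ _ h => (Tuple.sort f).injective h)
        (fun b hb => ⟨(Tuple.sort f).symm b, by
          simpa only [mem_filter_univ, Function.comp_apply, Fin.le_iff_val_le_val,
            Nat.lt_succ_iff, Equiv.apply_symm_apply] using hb, Equiv.apply_symm_apply _ _⟩)
    rw [this]
    rfl
  simp only [IsParkingFunction, key, IsParking, Fintype.card_fin]
  refine ⟨fun h j hj => ?_, fun h i => h _ i.2⟩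
  rcases j with _ | j
  · simp
  · exact h ⟨j, hj⟩

/-- The parking functions on `ι`, as a finite set. -/
noncomputable def parkingFinset (ι : Type*) [Fintype ι] : Finset (ι → ℕ) :=
  {f ∈ Fintype.piFinset fun _ => range (Fintype.card ι) | IsParking f}

theorem mem_parkingFinset {ι : Type*} [Fintype ι] {f : ι → ℕ} :
    f ∈ parkingFinset ι ↔ IsParking f := by
  simpa [parkingFinset] using fun hf : IsParking f => hf.lt_card

/-- The number of parking functions of size `n`. -/
noncomputable def parkingCount (n : ℕ) : ℕ := #(parkingFinset (Fin n))

theorem isParking_comp_equiv {ι κ : Type*} [Fintype ι] [Fintype κ] (e : ι ≃ κ) (f : κ → ℕ) :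
    IsParking (f ∘ e) ↔ IsParking f := by
  have (j : ℕ) : #{i | (f ∘ e) i < j} = #{i | f i < j} :=
    card_bij (fun i _ => e i) (by simp) (by simp)
      (fun b hb => ⟨e.symm b, by simpa using hb⟩)
  simp only [IsParking, this, Fintype.card_congr e]

theorem card_parkingFinset (ι : Type*) [Fintype ι] :
    #(parkingFinset ι) = parkingCount (Fintype.card ι) := by
  let e := Fintype.equivFin ι
  refine card_bij' (fun f _ => f ∘ e.symm) (fun f _ => f ∘ e) ?_ ?_ ?_ ?_
  · intro f hf
    rw [mem_parkingFinset] at *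
    rwa [isParking_comp_equiv]
  · intro f hf
    rw [mem_parkingFinset] at *
    rwa [isParking_comp_equiv]
  · intro f _
    ext
    simp
  · intro f _
    ext
    simp

theorem card_isParking (n : ℕ) :
    #{f : Fin n → Fin n | IsParking fun i => (f i : ℕ)} = parkingCount n := by
  refine card_bij (fun f _ i => (f i : ℕ)) ?_ ?_ ?_
  · intro f hf
    rw [mem_parkingFinset]
    simpa using hf
  · intro f _ g _ h
    ext i
    exact congrFun h i
  · intro f hf
    rw [mem_parkingFinset] at hf
    refine ⟨fun i => ⟨f i, by simpa using hf.lt_card i⟩, by simpa using hf, rfl⟩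

/-- The preferences `g` of all cars but one leave the last car exactly the choices `0, …, s`. -/
def LeavesRoom {κ : Type*} [Fintype κ] (s : ℕ) (g : κ → ℕ) : Prop :=
  (∀ j ≤ s, j ≤ #{i | g i < j}) ∧ #{i | g i < s + 1} = s ∧
    ∀ j ≤ Fintype.card κ + 1, j ≤ #{i | g i < j} + 1

theorem LeavesRoom.unique {κ : Type*} [Fintype κ] {s t : ℕ} {g : κ → ℕ} (hs : LeavesRoom s g)
    (ht : LeavesRoom t g) : s = t := by
  rcases lt_trichotomy s t with h | h | h
  · have := ht.1 (s + 1) h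
    have := hs.2.1
    omega
  · exact h
  · have := hs.1 (t + 1) h
    have := ht.2.1
    omega

theorem LeavesRoom.lt {κ : Type*} [Fintype κ] {s : ℕ} {g : κ → ℕ} (hs : LeavesRoom s g) (i : κ) :
    g i < Fintype.card κ + 1 := by
  have h : #{i | g i < Fintype.card κ + 1} = #(univ : Finset κ) := by
    refine le_antisymm (card_le_card (filter_subset _ _)) ?_
    have := hs.2.2 _ le_rfl
    rw [card_univ]
    omega
  exact (card_filter_eq_iff.1 h) i (mem_univ i)

theorem card_insertNth_lt {N : ℕ} (i : Fin (N + 1)) (v : ℕ) (g : Fin N → ℕ) (j : ℕ) :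
    #{l | (i.insertNth v g : Fin (N + 1) → ℕ) l < j} = (if v < j then 1 else 0) + #{l | g l < j} := by
  simp only [card_filter]
  rw [Fin.sum_univ_succAbove _ i]
  simp

theorem LeavesRoom.isParking_insertNth_iff {N s : ℕ} {g : Fin N → ℕ} (hg : LeavesRoom s g)
    (i : Fin (N + 1)) (v : ℕ) :
    IsParking (i.insertNth v g : Fin (N + 1) → ℕ) ↔ v ≤ s := by
  simp only [IsParking, card_insertNth_lt, Fintype.card_fin]
  obtain ⟨h1, h2, h3⟩ := hg
  simp only [Fintype.card_fin] at h3
  have hs : s ≤ N := by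
    rw [← h2]
    exact (card_le_univ _).trans (by simp)
  refine ⟨fun h => ?_, fun hv j hj => ?_⟩
  · have := h (s + 1) (by omega)
    split_ifs at this <;> omega
  · have := h3 j hj
    have := h1 j
    split_ifs <;> omega

theorem exists_leavesRoom {N : ℕ} {g : Fin N → ℕ} {i : Fin (N + 1)} {v : ℕ}
    (h : IsParking (i.insertNth v g : Fin (N + 1) → ℕ)) : ∃ s ≤ N, LeavesRoom s g := by
  simp only [IsParking, card_insertNth_lt, Fintype.card_fin] at h
  have h3 : ∀ j ≤ N + 1, j ≤ #{i | g i < j} + 1 := fun j hj => by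
    have := h j hj
    split_ifs at this <;> omega
  have hex : ∃ s, #{i | g i < s + 1} < s + 1 :=
    ⟨N, Nat.lt_succ_of_le ((card_le_univ _).trans (by simp))⟩
  have hN : Nat.find hex ≤ N :=
    Nat.find_min' hex (Nat.lt_succ_of_le ((card_le_univ _).trans (by simp)))
  refine ⟨Nat.find hex, hN, fun j hj => ?_, ?_, by simpa using h3⟩
  · rcases j with _ | j
    · simp
    · simpa using Nat.find_min hex hj
  · have := Nat.find_spec hex
    have := h3 (Nat.find hex + 1) (by omega)
    omega

/-- The preferences of `N` cars which leave one more car exactly the choices `0, …, s`. -/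
noncomputable def leavesRoomFinset (N s : ℕ) : Finset (Fin N → Fin (N + 1)) :=
  {g | LeavesRoom s fun i => (g i : ℕ)}

theorem coe_insertNth {N : ℕ} (i v : Fin (N + 1)) (g : Fin N → Fin (N + 1)) :
    (fun l => ((i.insertNth (α := fun _ => Fin (N + 1)) v g l : Fin (N + 1)) : ℕ)) =
      (i.insertNth (v : ℕ) (fun l => (g l : ℕ)) : Fin (N + 1) → ℕ) := by
  ext l
  rcases Fin.eq_self_or_eq_succAbove i l with rfl | ⟨l, rfl⟩ <;> simp

theorem sum_isParking {M : Type*} [AddCommMonoid M] {N : ℕ} (i : Fin (N + 1))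
    (F : (Fin (N + 1) → Fin (N + 1)) → M) :
    ∑ f : Fin (N + 1) → Fin (N + 1) with IsParking (fun l => (f l : ℕ)), F f =
      ∑ s ∈ range (N + 1), ∑ g ∈ leavesRoomFinset N s,
        ∑ v : Fin (N + 1) with v.val ≤ s, F (i.insertNth v g) := by
  rw [sum_filter, ← (Fin.insertNthEquiv (fun _ => Fin (N + 1)) i).sum_comp,
    Fintype.sum_prod_type_right]
  simp only [Fin.insertNthEquiv_apply, coe_insertNth, leavesRoomFinset]
  simp_rw [sum_filter]
  refine Eq.trans ?_ sum_comm
  refine Finset.sum_congr rfl fun g _ => ?_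
  by_cases h : ∃ s ≤ N, LeavesRoom s fun i => (g i : ℕ)
  · obtain ⟨s, hs, hg⟩ := h
    refine Eq.trans ?_ (sum_eq_single_of_mem s (by simpa [Nat.lt_succ_iff] using hs)
      fun t _ ht => if_neg fun h => ht (h.unique hg)).symm
    simp [hg, hg.isParking_insertNth_iff, Fin.insertNthEquiv]
  · exact (sum_eq_zero fun v _ => if_neg fun hv => h (exists_leavesRoom hv)).trans
      (sum_eq_zero fun s hs => if_neg fun hg =>
        h ⟨s, by simpa [Nat.lt_succ_iff] using hs, hg⟩).symm

end Combinatorics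

section Counting

open Finset
open scoped Classical

theorem LeavesRoom.card_filter_lt {κ : Type*} [Fintype κ] {s : ℕ} {g : κ → ℕ}
    (hg : LeavesRoom s g) : #{i | g i < s} = s := by
  refine le_antisymm ?_ (hg.1 s le_rfl)
  conv_rhs => rw [← hg.2.1]
  exact card_le_card fun i => by simpa using fun h => by omega

theorem LeavesRoom.ne {κ : Type*} [Fintype κ] {s : ℕ} {g : κ → ℕ} (hg : LeavesRoom s g) (i : κ) :
    g i ≠ s := fun h => by
  have h1 : ({i | g i < s} : Finset κ) = ({i | g i < s + 1} : Finset κ) :=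
    eq_of_subset_of_card_le (fun i => by simpa using fun h => by omega)
      (by rw [hg.card_filter_lt, hg.2.1])
  have h2 : i ∈ ({i | g i < s} : Finset κ) := by
    rw [h1]
    simp [h]
  simp [h] at h2

theorem card_filter_subtype_lt {κ : Type*} [Fintype κ] [DecidableEq κ] (S : Finset κ) (g : κ → ℕ) (j : ℕ) :
    #{i : S | g i < j} = #{i | i ∈ S ∧ g i < j} :=
  card_bij (fun i _ => i) (by simp) (by simp) (by simpa using fun b hS hb => ⟨hb, hS⟩)

/-- Preferences that leave room up to `s` are pairs of parking functions: one for the cars that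
prefer a spot below `s` and one for the cars that prefer a spot above `s`. -/
theorem leavesRoom_iff {κ : Type*} [Fintype κ] [DecidableEq κ] (S : Finset κ) (g : κ → ℕ) :
    (LeavesRoom #S g ∧ ({i | g i < #S} : Finset κ) = S) ↔
      IsParking (fun i : S => g i) ∧ (∀ i ∉ S, #S < g i) ∧
        IsParking (fun i : ↥(Sᶜ) => g i - (#S + 1)) := by
  have hcard : #S + #Sᶜ = Fintype.card κ := card_add_card_compl S
  have hsplit (j : ℕ) : #{i | g i < j} = #{i | i ∈ S ∧ g i < j} + #{i | i ∈ Sᶜ ∧ g i < j} := by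
    rw [← card_filter_add_card_filter_not (s := {i | g i < j}) (· ∈ S)]
    simp only [filter_filter, mem_compl, and_comm]
  constructor
  · rintro ⟨hg, hS⟩
    have hmem (i : κ) : i ∈ S ↔ g i < #S := by
      conv_lhs => rw [← hS]
      simp
    have hout : ∀ i ∉ S, #S < g i := fun i hi => by
      have := hg.ne i
      rw [hmem] at hi
      omega
    refine ⟨fun j hj => ?_, hout, fun j hj => ?_⟩
    · rw [Fintype.card_coe] at hj
      rw [card_filter_subtype_lt]
      refine (hg.1 j hj).trans (card_le_card fun i => ?_)
      simp only [mem_filter, mem_univ, true_and, hmem]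
      omega
    · rw [Fintype.card_coe] at hj
      have h1 : #{i : ↥(Sᶜ) | g i - (#S + 1) < j} = #{i | i ∈ Sᶜ ∧ g i < #S + 1 + j} := by
        rw [← card_filter_subtype_lt]
        congr 1
        ext i
        have := hout i (mem_compl.1 i.2)
        simp only [mem_filter, mem_univ, true_and]
        omega
      have h2 : #{i | i ∈ S ∧ g i < #S + 1 + j} = #S := by
        congr 1
        ext i
        simp only [mem_filter, mem_univ, true_and, hmem]
        omega
      have h3 := hg.2.2 (#S + 1 + j) (by omega)
      rw [hsplit, h2] at h3
      rw [h1]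
      omega
  · rintro ⟨h1, hout, h2⟩
    have hin (i : κ) (hi : i ∈ S) : g i < #S := by
      simpa using h1.lt_card ⟨i, hi⟩
    have hS : ({i | g i < #S} : Finset κ) = S := by
      ext i
      by_cases hi : i ∈ S
      · simpa [hi] using hin i hi
      · simpa [hi] using (hout i hi).le
    have h1' (j : ℕ) (hj : j ≤ #S) : j ≤ #{i | i ∈ S ∧ g i < j} := by
      rw [← card_filter_subtype_lt]
      exact h1 j (by simpa using hj)
    refine ⟨⟨fun j hj => ?_, ?_, fun j hj => ?_⟩, hS⟩
    · rw [hsplit]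
      exact (h1' j hj).trans (Nat.le_add_right _ _)
    · congr 1
      ext i
      by_cases hi : i ∈ S
      · simpa [hi] using (hin i hi).le
      · simpa [hi] using hout i hi
    · rw [hsplit]
      rcases le_or_gt j #S with h | h
      · have := h1' j h
        omega
      · have h3 : #{i | i ∈ S ∧ g i < j} = #S := by
          congr 1
          ext i
          simpa using fun hi => (hin i hi).trans h
        have h4 : j - (#S + 1) ≤ #{i : ↥(Sᶜ) | g i - (#S + 1) < j - (#S + 1)} :=
          h2 (j - (#S + 1)) (by rw [Fintype.card_coe]; omega)
        have h5 : #{i : ↥(Sᶜ) | g i - (#S + 1) < j - (#S + 1)} ≤ #{i | i ∈ Sᶜ ∧ g i < j} := by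
          rw [← card_filter_subtype_lt]
          refine card_le_card fun i => ?_
          simp only [mem_filter, mem_univ, true_and]
          omega
        omega

theorem card_leavesRoomFinset (N s : ℕ) :
    #(leavesRoomFinset N s) = N.choose s * parkingCount s * parkingCount (N - s) := by
  have hfib (S : Finset (Fin N)) (hS : #S = s) :
      #{g ∈ leavesRoomFinset N s | ({i | (g i : ℕ) < s} : Finset (Fin N)) = S} =
        parkingCount s * parkingCount (N - s) := by
    have e1 : #(parkingFinset S) = parkingCount s := by
      rw [card_parkingFinset, Fintype.card_coe, hS]
    have e2 : #(parkingFinset ↥(Sᶜ)) = parkingCount (N - s) := by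
      rw [card_parkingFinset, Fintype.card_coe, card_compl, hS, Fintype.card_fin]
    rw [← e1, ← e2, ← card_product]
    subst hS
    have hchar (g : Fin N → Fin (N + 1)) :
        g ∈ ({g ∈ leavesRoomFinset N #S | ({i | (g i : ℕ) < #S} : Finset (Fin N)) = S} :
            Finset (Fin N → Fin (N + 1))) ↔
          IsParking (fun i : S => (g i : ℕ)) ∧ (∀ i ∉ S, #S < (g i : ℕ)) ∧
            IsParking (fun i : ↥(Sᶜ) => (g i : ℕ) - (#S + 1)) := by
      rw [← leavesRoom_iff S fun i => (g i : ℕ)]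
      simp [leavesRoomFinset]
    refine card_bij (fun g _ => (fun i : S => (g i : ℕ), fun i : ↥(Sᶜ) => (g i : ℕ) - (#S + 1)))
      ?_ ?_ ?_
    · intro g hg
      rw [hchar] at hg
      rw [mem_product, mem_parkingFinset, mem_parkingFinset]
      exact ⟨hg.1, hg.2.2⟩
    · intro g hg g' hg' h
      rw [hchar] at hg hg'
      rw [Prod.mk.injEq] at h
      ext i
      by_cases hi : i ∈ S
      · exact congrFun h.1 ⟨i, hi⟩
      · have h1 := congrFun h.2 ⟨i, mem_compl.2 hi⟩
        have h2 := hg.2.1 i hi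
        have h3 := hg'.2.1 i hi
        simp only at h1
        omega
    · rintro ⟨a, b⟩ hab
      rw [mem_product, mem_parkingFinset, mem_parkingFinset] at hab
      obtain ⟨ha, hb⟩ := hab
      let g : Fin N → ℕ := fun i =>
        if h : i ∈ S then a ⟨i, h⟩ else b ⟨i, mem_compl.2 h⟩ + (#S + 1)
      have ga : (fun i : S => g i) = a := by
        ext i
        simp [g]
      have gb : (fun i : ↥(Sᶜ) => g i - (#S + 1)) = b := by
        ext i
        simp [g, mem_compl.1 i.2]
      have hout : ∀ i ∉ S, #S < g i := fun i hi => by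
        simp only [g, hi, dite_false]
        omega
      have hg := (leavesRoom_iff S g).2 ⟨by rwa [ga], hout, by rwa [gb]⟩
      refine ⟨fun i => ⟨g i, by simpa using hg.1.lt i⟩, ?_, ?_⟩
      · rw [hchar]
        exact ⟨by simpa only [ga] using ha, hout, by simpa only [gb] using hb⟩
      · simp only [ga, gb]
  rw [card_eq_sum_card_fiberwise (f := fun g => ({i | (g i : ℕ) < s} : Finset (Fin N)))
    (t := powersetCard s univ)]
  · rw [sum_congr rfl fun S hS => hfib S (mem_powersetCard.1 hS).2]
    simp [mul_assoc]
  · intro g hg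
    have hg : LeavesRoom s fun i => (g i : ℕ) := by simpa [leavesRoomFinset] using hg
    simpa using hg.card_filter_lt

theorem parkingCount_succ (N : ℕ) :
    parkingCount (N + 1) =
      ∑ s ∈ range (N + 1), N.choose s * parkingCount s * parkingCount (N - s) * (s + 1) := by
  rw [← card_isParking, card_eq_sum_ones, sum_isParking 0]
  refine sum_congr rfl fun s hs => ?_
  rw [← card_leavesRoomFinset, sum_const_nat (m := s + 1)]
  intro g _
  rw [sum_const, smul_eq_mul, mul_one]
  have : ({v | (v : ℕ) ≤ s} : Finset (Fin (N + 1))) = Iic ⟨s, mem_range.1 hs⟩ := by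
    ext v
    simp [Fin.le_def]
  rw [this, Fin.card_Iic]

theorem abel_identity (n : ℕ) (y : ℝ) :
    ∑ k ∈ range (n + 1), (n.choose k : ℝ) * (k + 1) ^ (k - 1) * (y - k) ^ (n - k) =
      (1 + y) ^ n := by
  induction n generalizing y with
  | zero => simp
  | succ n ih =>
    have hd (y : ℝ) : HasDerivAt (fun y : ℝ => ∑ k ∈ range (n + 2),
        ((n + 1).choose k : ℝ) * (k + 1) ^ (k - 1) * (y - k) ^ (n + 1 - k) - (1 + y) ^ (n + 1))
        0 y := by
      have h : HasDerivAt (fun y : ℝ => ∑ k ∈ range (n + 2),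
          ((n + 1).choose k : ℝ) * (k + 1) ^ (k - 1) * (y - k) ^ (n + 1 - k) - (1 + y) ^ (n + 1))
          (∑ k ∈ range (n + 2), ((n + 1).choose k : ℝ) * (k + 1) ^ (k - 1) *
            ((n + 1 - k : ℕ) * (y - k) ^ (n + 1 - k - 1) * 1) -
              (n + 1 : ℕ) * (1 + y) ^ (n + 1 - 1) * 1) y := by
        refine HasDerivAt.sub (HasDerivAt.fun_sum fun k _ => ?_) ?_
        · exact (((hasDerivAt_id y).sub_const _).pow _).const_mul _
        · exact ((hasDerivAt_id y).const_add _).pow _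
      convert h using 1
      rw [sum_range_succ, Nat.add_sub_cancel, ← ih, mul_sum, eq_comm, Nat.sub_self]
      simp only [Nat.cast_zero, zero_mul, mul_zero, add_zero, mul_one]
      rw [sub_eq_zero]
      refine sum_congr rfl fun k hk => ?_
      have hk : k ≤ n := Nat.lt_succ_iff.1 (mem_range.1 hk)
      have h1 : ((n + 1).choose k : ℝ) * (n + 1 - k : ℕ) = (n + 1 : ℕ) * n.choose k := by
        exact_mod_cast (Nat.choose_mul_succ_eq n k).symm.trans (mul_comm _ _)
      rw [show n + 1 - k - 1 = n - k by omega]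
      linear_combination (k + 1 : ℝ) ^ (k - 1) * (y - k) ^ (n - k) * h1
    have hc := is_const_of_deriv_eq_zero (fun y => (hd y).differentiableAt) (fun y => (hd y).deriv)
      y (-1)
    have h0 : ∑ k ∈ range (n + 2),
        ((n + 1).choose k : ℝ) * (k + 1) ^ (k - 1) * (-1 - k) ^ (n + 1 - k) = 0 := by
      have := congrFun (fwdDiff_iter_pow_eq_zero_of_lt (R := ℝ) (Nat.lt_succ_self n)) 1
      rw [fwdDiff_iter_eq_sum_shift] at this
      simp only [Pi.zero_apply, zsmul_eq_mul, nsmul_eq_mul, mul_one] at this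
      rw [← this]
      refine sum_congr rfl fun k hk => ?_
      have hk : k ≤ n + 1 := Nat.lt_succ_iff.1 (mem_range.1 hk)
      rw [show (-1 - k : ℝ) = (-1) * (k + 1) by ring, mul_pow]
      push_cast
      rcases k with _ | k
      · simp
      · rw [show n = k + (n - k) by omega, pow_add]
        simp only [Nat.add_sub_cancel,
          show k + (n - k) = n by omega]
        push_cast
        ring
    simp only [h0] at hc
    norm_num at hc
    linarith

theorem parkingCount_eq (n : ℕ) : (parkingCount n : ℝ) = (n + 1 : ℝ) ^ (n - 1) := by
  induction n using Nat.strong_induction_on with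
  | _ n ih =>
    rcases n with _ | N
    · simp [parkingCount, parkingFinset, IsParking]
    · have h := abel_identity N (N + 1)
      rw [parkingCount_succ, ← sum_range_reflect]
      push_cast
      rw [show (N + 1 + 1 : ℝ) = 1 + (N + 1) by ring, ← h]
      refine sum_congr rfl fun k hk => ?_
      have hk : k ≤ N := Nat.lt_succ_iff.1 (mem_range.1 hk)
      rw [Nat.sub_sub_self hk, Nat.choose_symm hk,
        ih k (by omega), ih (N - k) (by omega)]
      rcases hk.eq_or_lt with rfl | hk'
      · simp
      · obtain ⟨m, rfl⟩ := Nat.exists_eq_add_of_lt hk'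
        rw [show k + m + 1 - k = m + 1 by omega]
        push_cast
        ring

end Counting

section Asymptotics

open Finset

theorem add_one_pow_le_factorial_mul (a : ℕ) :
    (a + 1 : ℝ) ^ a * √(2 * Real.pi * (a + 1)) ≤ a.factorial * Real.exp (a + 1) := by
  have h := Stirling.le_factorial_stirling (a + 1)
  rw [div_pow, ← Real.exp_nat_mul, mul_one, Nat.factorial_succ, mul_div_assoc', pow_succ,
    div_le_iff₀ (Real.exp_pos _)] at h
  push_cast at h
  have ha : (0 : ℝ) < a + 1 := by positivity
  refine le_of_mul_le_mul_left ?_ ha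
  linarith

theorem factorial_le_exp_mul (n : ℕ) (hn : n ≠ 0) :
    (n.factorial : ℝ) * Real.exp n ≤ Real.exp 1 * √n * n ^ n := by
  obtain ⟨m, rfl⟩ := Nat.exists_eq_succ_of_ne_zero hn
  have h := Stirling.stirlingSeq'_antitone (Nat.zero_le m)
  simp only [Function.comp_apply, Nat.succ_eq_add_one, zero_add, Stirling.stirlingSeq_one] at h
  rw [Stirling.stirlingSeq, div_le_iff₀ (by positivity), div_pow, ← Real.exp_nat_mul, mul_one,
    Real.sqrt_mul (by norm_num)] at h
  have h2 : √(2 : ℝ) ≠ 0 := by positivity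
  have hE := Real.exp_pos ((m + 1 : ℕ) : ℝ)
  calc ((m + 1).factorial : ℝ) * Real.exp (m + 1 : ℕ)
      ≤ Real.exp 1 / √2 * (√2 * √(m + 1 : ℕ) * ((m + 1 : ℕ) ^ (m + 1) / Real.exp (m + 1 : ℕ))) *
          Real.exp (m + 1 : ℕ) := mul_le_mul_of_nonneg_right h hE.le
    _ = _ := by field_simp

theorem factorial_mul_exp_le (N : ℕ) :
    (N.factorial : ℝ) * Real.exp (N + 2) ≤ 2 * Real.exp 1 * √(N + 2) * (N + 2) ^ N := by
  have h := factorial_le_exp_mul (N + 2) (by omega)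
  rw [Nat.factorial_succ, Nat.factorial_succ] at h
  push_cast at h
  rw [show (N + 1 + 1 : ℝ) = N + 2 by ring] at h
  have h1 : (N.factorial : ℝ) * Real.exp (N + 2) * (N + 1) ≤
      Real.exp 1 * √(N + 2) * (N + 2) ^ N * (N + 2) := by
    refine le_of_mul_le_mul_left ?_ (by positivity : (0 : ℝ) < N + 2)
    calc _ = ((N : ℝ) + 2) * ((N + 1) * N.factorial) * Real.exp (N + 2) := by ring
      _ ≤ _ := h
      _ = _ := by ring
  have h2 : Real.exp 1 * √(N + 2) * (N + 2 : ℝ) ^ N * (N + 2) ≤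
      2 * Real.exp 1 * √(N + 2) * (N + 2) ^ N * (N + 1) := by
    have : (0 : ℝ) ≤ Real.exp 1 * √(N + 2) * (N + 2) ^ N := by positivity
    nlinarith [mul_nonneg this (Nat.cast_nonneg (α := ℝ) N)]
  exact le_of_mul_le_mul_right (h1.trans h2) (by positivity)

theorem choose_mul_pow_mul_pow_le (a b : ℕ) :
    ((a + b).choose a : ℝ) * (a + 1) ^ a * (b + 1) ^ b ≤
      ((a + b : ℕ) + 2) ^ (a + b) * (1 / √(a + 1) + 1 / √(b + 1)) := by
  set x := √((a : ℝ) + 1) with hx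
  set y := √((b : ℝ) + 1) with hy
  have hx0 : 0 < x := by positivity
  have hy0 : 0 < y := by positivity
  have hp : 0 < √(2 * Real.pi) := by positivity
  have ha := add_one_pow_le_factorial_mul a
  have hb := add_one_pow_le_factorial_mul b
  rw [Real.sqrt_mul (by positivity)] at ha hb
  have hN := factorial_mul_exp_le (a + b)
  have hchoose : ((a + b).choose a : ℝ) * (a.factorial * b.factorial) = (a + b).factorial := by
    rw [← mul_assoc]
    exact_mod_cast Nat.choose_symm_add ▸ Nat.add_choose_mul_factorial_mul_factorial a b
  have hsqrt : √((a + b : ℕ) + 2 : ℝ) ≤ x + y := by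
    rw [Real.sqrt_le_left (by positivity)]
    have := Real.sq_sqrt (show (0 : ℝ) ≤ a + 1 by positivity)
    have := Real.sq_sqrt (show (0 : ℝ) ≤ b + 1 by positivity)
    push_cast
    nlinarith [mul_pos hx0 hy0]
  have hpi : Real.exp 1 ≤ Real.pi := by
    linarith [Real.exp_one_lt_d9, Real.pi_gt_three]
  have hP : (0 : ℝ) < 2 * Real.pi * (x * y) := by positivity
  refine le_of_mul_le_mul_right ?_ hP
  calc ((a + b).choose a : ℝ) * (a + 1) ^ a * (b + 1) ^ b * (2 * Real.pi * (x * y))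
      = (a + b).choose a * (((a + 1) ^ a * (√(2 * Real.pi) * x)) *
          ((b + 1) ^ b * (√(2 * Real.pi) * y))) := by
        rw [← Real.sq_sqrt (show 0 ≤ 2 * Real.pi by positivity)]
        simp only [Real.sqrt_sq hp.le]
        ring
    _ ≤ (a + b).choose a * ((a.factorial * Real.exp (a + 1)) * (b.factorial * Real.exp (b + 1))) := by
        gcongr
    _ = (a + b).factorial * Real.exp ((a + b : ℕ) + 2) := by
        rw [← hchoose, show ((a + b : ℕ) + 2 : ℝ) = (a + 1) + (b + 1) by push_cast; ring,
          Real.exp_add (a + 1 : ℝ)]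
        ring
    _ ≤ 2 * Real.exp 1 * √((a + b : ℕ) + 2) * ((a + b : ℕ) + 2) ^ (a + b) := hN
    _ ≤ 2 * Real.pi * (x + y) * ((a + b : ℕ) + 2) ^ (a + b) := by gcongr
    _ = _ := by
        field_simp
        ring

theorem min_one_div_mul_le (T j : ℕ) (hT : 1 ≤ T) :
    min 1 (T / (j + 1) : ℝ) * (1 / √(j + 1)) ≤
      (if j + 1 ≤ T then 2 * √((j + 1 : ℕ) : ℝ) else 4 * √T - 2 * T / √((j + 1 : ℕ) : ℝ)) -
        (if j ≤ T then 2 * √(j : ℝ) else 4 * √T - 2 * T / √(j : ℝ)) := by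
  have hx0 : (0 : ℝ) ≤ √j := by positivity
  have hy0 : (0 : ℝ) < √(j + 1) := by positivity
  have hx := Real.sq_sqrt (Nat.cast_nonneg (α := ℝ) j)
  have hy := Real.sq_sqrt (show (0 : ℝ) ≤ j + 1 by positivity)
  have hxy : √(j : ℝ) ≤ √(j + 1) := Real.sqrt_le_sqrt (by linarith)
  push_cast
  generalize √(j : ℝ) = x at *
  generalize √((j : ℝ) + 1) = y at *
  have hdiff : 1 / y ≤ 2 * (y - x) := by
    rw [div_le_iff₀ hy0]
    nlinarith [sq_nonneg (y - x)]
  rcases lt_or_ge j T with h | h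
  · rw [if_pos (by omega), if_pos h.le]
    calc _ ≤ 1 * (1 / y) := by gcongr; exact min_le_left _ _
      _ ≤ _ := by linarith
  · have hTj : (T : ℝ) ≤ j := by exact_mod_cast h
    have hT' : (1 : ℝ) ≤ T := by exact_mod_cast hT
    have hxp : 0 < x := by
      rcases hx0.eq_or_lt with h0 | h0
      · rw [← h0] at hx
        nlinarith
      · exact h0
    rw [if_neg (by omega)]
    have hb : (if j ≤ T then 2 * x else 4 * √T - 2 * T / x) = 4 * √T - 2 * T / x := by
      split_ifs with h1
      · have : (T : ℝ) = x ^ 2 := by rw [hx]; exact_mod_cast le_antisymm h h1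
        rw [this, Real.sqrt_sq hx0]
        field_simp
        ring
      · rfl
    rw [hb]
    have hstep : 1 / y ^ 2 * (1 / y) ≤ 2 * (1 / x - 1 / y) := by
      rw [show 1 / y ^ 2 * (1 / y) = 1 / y ^ 3 by field_simp,
        show 2 * (1 / x - 1 / y) = 2 * (y - x) / (x * y) by field_simp,
        div_le_div_iff₀ (by positivity) (by positivity)]
      have h1 : 1 ≤ 2 * (y - x) * y := by rwa [div_le_iff₀ hy0] at hdiff
      have h2 : x * y ≤ y ^ 2 := by nlinarith
      nlinarith [mul_le_mul_of_nonneg_right h1 (sq_nonneg y)]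
    calc _ ≤ (T / (j + 1) : ℝ) * (1 / y) := by gcongr; exact min_le_right _ _
      _ = T * (1 / y ^ 2 * (1 / y)) := by rw [← hy]; ring
      _ ≤ T * (2 * (1 / x - 1 / y)) := by gcongr
      _ = _ := by ring

theorem sum_min_one_div_le (T n : ℕ) :
    ∑ j ∈ range n, min 1 (T / (j + 1) : ℝ) * (1 / √(j + 1)) ≤ 4 * √T := by
  rcases Nat.eq_zero_or_pos T with rfl | hT
  · simp
  refine (sum_le_sum fun j _ => min_one_div_mul_le T j hT).trans ?_
  have := sum_range_sub
    (fun j : ℕ => if j ≤ T then 2 * √(j : ℝ) else 4 * √T - 2 * T / √(j : ℝ)) n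
  rw [this]
  simp only [Nat.zero_le, if_true, Nat.cast_zero, Real.sqrt_zero, mul_zero, sub_zero]
  split_ifs with h
  · have : √(n : ℝ) ≤ √T := Real.sqrt_le_sqrt (by exact_mod_cast h)
    linarith [Real.sqrt_nonneg (T : ℝ)]
  · have : 0 ≤ 2 * (T : ℝ) / √n := by positivity
    linarith

theorem sum_min_mul_reflect_le (T N : ℕ) :
    ∑ j ∈ range (N + 1), min 1 (T / (j + 1) : ℝ) * (1 / √((N - j : ℕ) + 1)) ≤ 4 * √T := by
  refine le_trans ?_ (sum_min_one_div_le T (N + 1))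
  rw [← Fin.sum_univ_eq_sum_range
      (fun j : ℕ => min 1 (T / (j + 1) : ℝ) * (1 / √((N - j : ℕ) + 1))),
    ← Fin.sum_univ_eq_sum_range (fun j : ℕ => min 1 (T / (j + 1) : ℝ) * (1 / √((j : ℝ) + 1)))]
  have hf : Antitone fun j : Fin (N + 1) => min 1 (T / ((j : ℕ) + 1) : ℝ) := fun i j hij => by
    have : ((i : ℕ) : ℝ) ≤ (j : ℕ) := by exact_mod_cast hij
    exact min_le_min_left _ (by gcongr)
  have hg : Antitone fun j : Fin (N + 1) => 1 / √(((j : ℕ) : ℝ) + 1) := fun i j hij => by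
    have : ((i : ℕ) : ℝ) ≤ (j : ℕ) := by exact_mod_cast hij
    exact one_div_le_one_div_of_le (by positivity) (Real.sqrt_le_sqrt (by linarith))
  have := (hf.monovary hg).sum_mul_comp_perm_le_sum_mul (σ := Fin.revPerm)
  refine le_of_eq_of_le (sum_congr rfl fun j _ => ?_) this
  simp only [Fin.revPerm_apply, Fin.val_rev, Nat.add_sub_add_right]

/-- If `M` is the number of choices of the last car, given the other ones, this bounds the mean of
`min T (N + 1 - M)`. -/
theorem sum_parkingCount_mul_min_le (N T : ℕ) :
    ∑ s ∈ range (N + 1), (N.choose s * parkingCount s * parkingCount (N - s) : ℝ) *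
      ((s + 1) * min (T : ℝ) (N - s : ℕ)) ≤ 8 * √T * parkingCount (N + 1) := by
  have hterm (j : ℕ) (hj : j ∈ range (N + 1)) :
      (N.choose (N - j) * parkingCount (N - j) * parkingCount (N - (N - j)) : ℝ) *
        (((N - j : ℕ) + 1) * min (T : ℝ) (N - (N - j) : ℕ)) ≤
      (N + 2) ^ N * (min 1 (T / (j + 1) : ℝ) * (1 / √(j + 1)) +
        min 1 (T / (j + 1) : ℝ) * (1 / √((N - j : ℕ) + 1))) := by
    have hj : j ≤ N := Nat.lt_succ_iff.1 (mem_range.1 hj)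
    obtain ⟨b, rfl⟩ := Nat.exists_eq_add_of_le hj
    have h := choose_mul_pow_mul_pow_le j b
    rw [Nat.sub_sub_self hj, Nat.choose_symm hj, Nat.add_sub_cancel_left, parkingCount_eq,
      parkingCount_eq]
    have hm : min (T : ℝ) j ≤ min 1 (T / (j + 1) : ℝ) * (j + 1) := by
      rw [min_mul_of_nonneg _ _ (by positivity), div_mul_cancel₀ _ (by positivity), min_comm]
      exact min_le_min_right _ (by linarith)
    have hb : (b + 1 : ℝ) ^ (b - 1) * (b + 1) = (b + 1) ^ b := by
      rcases b with _ | b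
      · simp
      · rw [Nat.add_sub_cancel, pow_succ]
    have hj' : (j + 1 : ℝ) ^ (j - 1) * (j + 1) = (j + 1) ^ j := by
      rcases j with _ | j
      · simp
      · rw [Nat.add_sub_cancel, pow_succ]
    calc _ ≤ ((j + b).choose j * (b + 1) ^ (b - 1) * (j + 1) ^ (j - 1) : ℝ) *
          ((b + 1) * (min 1 (T / (j + 1) : ℝ) * (j + 1))) := by gcongr
      _ = ((j + b).choose j * (j + 1) ^ j * (b + 1) ^ b : ℝ) * min 1 (T / (j + 1) : ℝ) := by
          rw [← hb, ← hj']
          ring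
      _ ≤ ((j + b : ℕ) + 2) ^ (j + b) * (1 / √(j + 1) + 1 / √(b + 1)) *
          min 1 (T / (j + 1) : ℝ) := by gcongr
      _ = _ := by ring
  rw [← sum_range_reflect]
  refine (sum_le_sum hterm).trans ?_
  rw [← mul_sum, sum_add_distrib, parkingCount_eq]
  push_cast
  rw [show (N + 1 + 1 : ℝ) = N + 2 by ring, mul_comm (8 * √T)]
  gcongr
  linarith [sum_min_one_div_le T (N + 1), sum_min_mul_reflect_le T N]

end Asymptotics

section Decoupling

open Finset
open scoped Classical

theorem norm_sum_sub_mul_prod_le {N T : ℕ} {K : ℝ} {e : Fin (N + 1) → ℂ} (he : ∀ v, ‖e v‖ ≤ 1)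
    {φ : ℂ} (hK : 0 ≤ K)
    (h : ∀ s ≤ N, ‖∑ v : Fin (N + 1) with v.val ≤ s, e v - (s + 1) * φ‖ ≤
      K * ((s + 1) * min (T : ℝ) (N - s : ℕ)))
    {i : Fin (N + 1)} {S : Finset (Fin (N + 1))} (hi : i ∉ S) :
    ‖∑ f : Fin (N + 1) → Fin (N + 1) with IsParking (fun l => (f l : ℕ)),
      (e (f i) - φ) * ∏ l ∈ S, e (f l)‖ ≤ K * (8 * √T * parkingCount (N + 1)) := by
  rw [sum_isParking i]
  have hg (s : ℕ) (hs : s ∈ range (N + 1)) (g : Fin N → Fin (N + 1)) :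
      ‖∑ v : Fin (N + 1) with v.val ≤ s,
        (e ((i.insertNth v g : Fin (N + 1) → Fin (N + 1)) i) - φ) *
          ∏ l ∈ S, e ((i.insertNth v g : Fin (N + 1) → Fin (N + 1)) l)‖ ≤
        K * ((s + 1) * min (T : ℝ) (N - s : ℕ)) := by
    have hprod (v : Fin (N + 1)) :
        ∏ l ∈ S, e ((i.insertNth v g : Fin (N + 1) → Fin (N + 1)) l) =
          ∏ l ∈ S, e ((i.insertNth 0 g : Fin (N + 1) → Fin (N + 1)) l) := by
      refine prod_congr rfl fun l hl => ?_
      obtain ⟨m, rfl⟩ := Fin.exists_succAbove_eq (x := l) (y := i) fun h => hi (h ▸ hl)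
      exact congrArg e ((Fin.insertNth_apply_succAbove (α := fun _ => Fin (N + 1)) i v g m).trans
        (Fin.insertNth_apply_succAbove (α := fun _ => Fin (N + 1)) i 0 g m).symm)
    have hnorm : ‖∏ l ∈ S, e ((i.insertNth 0 g : Fin (N + 1) → Fin (N + 1)) l)‖ ≤ 1 := by
      rw [norm_prod]
      exact prod_le_one (fun _ _ => norm_nonneg _) fun _ _ => he _
    simp_rw [hprod, Fin.insertNth_apply_same]
    rw [← sum_mul, norm_mul, sum_sub_distrib, sum_const]
    have hcard : #{v : Fin (N + 1) | v.val ≤ s} = s + 1 := by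
      have : ({v | v.val ≤ s} : Finset (Fin (N + 1))) = Iic ⟨s, mem_range.1 hs⟩ := by
        ext v
        simp [Fin.le_def]
      rw [this, Fin.card_Iic]
    rw [hcard, nsmul_eq_mul]
    push_cast
    exact (mul_le_of_le_one_right (norm_nonneg _) hnorm).trans
      (h s (Nat.lt_succ_iff.1 (mem_range.1 hs)))
  calc _ ≤ ∑ s ∈ range (N + 1), ∑ g ∈ leavesRoomFinset N s,
        K * ((s + 1) * min (T : ℝ) (N - s : ℕ)) :=
        norm_sum_le_of_le _ fun s hs => norm_sum_le_of_le _ fun g _ => hg s hs g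
    _ = K * ∑ s ∈ range (N + 1), (N.choose s * parkingCount s * parkingCount (N - s) : ℝ) *
          ((s + 1) * min (T : ℝ) (N - s : ℕ)) := by
        rw [mul_sum]
        refine sum_congr rfl fun s _ => ?_
        rw [sum_const, card_leavesRoomFinset, nsmul_eq_mul]
        push_cast
        ring
    _ ≤ _ := mul_le_mul_of_nonneg_left (sum_parkingCount_mul_min_le N T) hK

/-- Products over `S` of functions of single preferences nearly have the same mean under uniform
parking functions as under independent uniform preferences. -/
theorem norm_sum_prod_sub_le {N T : ℕ} {K : ℝ} {e : Fin (N + 1) → ℂ} (he : ∀ v, ‖e v‖ ≤ 1)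
    {φ : ℂ} (hφ : ‖φ‖ ≤ 1) (hK : 0 ≤ K)
    (h : ∀ s ≤ N, ‖∑ v : Fin (N + 1) with v.val ≤ s, e v - (s + 1) * φ‖ ≤
      K * ((s + 1) * min (T : ℝ) (N - s : ℕ)))
    (S : Finset (Fin (N + 1))) :
    ‖∑ f : Fin (N + 1) → Fin (N + 1) with IsParking (fun l => (f l : ℕ)), ∏ l ∈ S, e (f l) -
      parkingCount (N + 1) * φ ^ #S‖ ≤ #S * (K * (8 * √T * parkingCount (N + 1))) := by
  induction S using Finset.induction_on with
  | empty => simp [card_isParking]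
  | insert i S hi ih =>
    have h1 := norm_sum_sub_mul_prod_le he hK h hi
    simp_rw [prod_insert hi, card_insert_of_notMem hi]
    simp_rw [sub_mul, sum_sub_distrib, ← mul_sum] at h1
    set X := ∑ f : Fin (N + 1) → Fin (N + 1) with IsParking (fun l => (f l : ℕ)),
      ∏ l ∈ S, e (f l)
    set Y := ∑ f : Fin (N + 1) → Fin (N + 1) with IsParking (fun l => (f l : ℕ)),
      e (f i) * ∏ l ∈ S, e (f l)
    calc ‖Y - parkingCount (N + 1) * φ ^ (#S + 1)‖
        = ‖(Y - φ * X) + φ * (X - parkingCount (N + 1) * φ ^ #S)‖ := by ring_nf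
      _ ≤ ‖Y - φ * X‖ + ‖φ‖ * ‖X - parkingCount (N + 1) * φ ^ #S‖ := by
          rw [← norm_mul]
          exact norm_add_le _ _
      _ ≤ K * (8 * √T * parkingCount (N + 1)) +
          1 * (#S * (K * (8 * √T * parkingCount (N + 1)))) := by gcongr
      _ = _ := by
          push_cast
          ring

end Decoupling

section Law

open scoped Classical

theorem parkingCount_pos (n : ℕ) : 0 < parkingCount n := by
  have : (0 : ℝ) < parkingCount n := by
    rw [parkingCount_eq]
    positivity
  exact_mod_cast this

theorem uniformParking_eq (n : ℕ) : uniformParking n =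
    uniformOn (({f | IsParking fun l => (f l : ℕ)} : Finset (Fin n → Fin n)) :
      Set (Fin n → Fin n)) := by
  rw [uniformParking]
  congr 1
  ext f
  simp [isParkingFunction_iff]

instance isProbabilityMeasure_uniformParking (n : ℕ) : IsProbabilityMeasure (uniformParking n) := by
  rw [uniformParking_eq]
  refine isProbabilityMeasure_uniformOn (Finset.finite_toSet _) ?_
  rw [Finset.coe_nonempty, ← Finset.card_pos, card_isParking]
  exact parkingCount_pos n

theorem integral_uniformParking {n : ℕ} (F : (Fin n → Fin n) → ℂ) :
    ∫ f, F f ∂uniformParking n =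
      (∑ f : Fin n → Fin n with IsParking (fun l => (f l : ℕ)), F f) / parkingCount n := by
  have hreal (f : Fin n → Fin n) : (uniformParking n).real {f} =
      if IsParking (fun l => (f l : ℕ)) then (parkingCount n : ℝ)⁻¹ else 0 := by
    rw [uniformParking_eq, measureReal_def, ← Finset.coe_singleton, uniformOn_apply_finset,
      card_isParking]
    split_ifs with h
    · rw [Finset.inter_singleton_of_mem (by simpa using h)]
      simp
    · rw [Finset.inter_singleton_of_notMem (by simpa using h)]
      simp
  rw [integral_fintype (by simp), Finset.sum_filter, Finset.sum_div]
  refine Finset.sum_congr rfl fun f _ => ?_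
  rw [hreal]
  split_ifs <;> simp [div_eq_inv_mul]

theorem norm_integral_prod_sub_le {N T : ℕ} {K : ℝ} {e : Fin (N + 1) → ℂ} (he : ∀ v, ‖e v‖ ≤ 1)
    {φ : ℂ} (hφ : ‖φ‖ ≤ 1) (hK : 0 ≤ K)
    (h : ∀ s ≤ N, ‖∑ v : Fin (N + 1) with v.val ≤ s, e v - (s + 1) * φ‖ ≤
      K * ((s + 1) * min (T : ℝ) (N - s : ℕ)))
    (S : Finset (Fin (N + 1))) :
    ‖∫ f, ∏ l ∈ S, e (f l) ∂uniformParking (N + 1) - φ ^ S.card‖ ≤ S.card * (K * (8 * √T)) := by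
  have hA : (0 : ℝ) < parkingCount (N + 1) := by exact_mod_cast parkingCount_pos (N + 1)
  have hA' : (parkingCount (N + 1) : ℂ) ≠ 0 := by exact_mod_cast hA.ne'
  rw [integral_uniformParking, div_sub' hA', norm_div, Complex.norm_natCast, div_le_iff₀ hA]
  exact (norm_sum_prod_sub_le he hφ hK h S).trans_eq (by ring)

end Law

section Limits

open Topology

theorem Complex.tendsto_one_add_pow_of_tendsto_mul {ι : Type*} {l : Filter ι} {k : ι → ℕ}
    {z : ι → ℂ} {c : ℂ} (hk : Tendsto k l atTop) (h : Tendsto (fun i => k i * z i) l (𝓝 c)) :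
    Tendsto (fun i => (1 + z i) ^ k i) l (𝓝 (Complex.exp c)) := by
  have hinv : Tendsto (fun i => ((k i : ℂ))⁻¹) l (𝓝 0) :=
    (tendsto_inv_atTop_nhds_zero_nat (𝕜 := ℂ)).comp hk
  have hz : Tendsto z l (𝓝 0) := by
    have := h.mul hinv
    rw [mul_zero] at this
    refine this.congr' ?_
    filter_upwards [hk.eventually_ne_atTop 0] with i hi
    field_simp
  have hlog : Tendsto (fun i => k i * Complex.log (1 + z i)) l (𝓝 c) := by
    have h1 : (fun i => Complex.log (1 + z i) - z i) =O[l] fun i => z i ^ 2 :=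
      Complex.log_sub_self_isBigO.comp_tendsto hz
    have h2 : (fun i => k i * (Complex.log (1 + z i) - z i)) =O[l] fun i => k i * z i ^ 2 :=
      (isBigO_refl _ _).mul h1
    have h3 : Tendsto (fun i => k i * z i ^ 2) l (𝓝 0) := by
      have := h.mul hz
      rw [mul_zero] at this
      exact this.congr fun i => by ring
    have := h.add (h2.trans_tendsto h3)
    rw [add_zero] at this
    exact this.congr fun i => by ring
  refine ((Complex.continuous_exp.tendsto c).comp hlog).congr' ?_
  filter_upwards [hz.eventually_ne (show (0 : ℂ) ≠ -1 by simp)] with i hi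
  have h1 : 1 + z i ≠ 0 := fun h0 => hi (by linear_combination h0)
  simp [Complex.exp_nat_mul, Complex.exp_log h1]

theorem ProbabilityMeasure.tendsto_of_tendsto_real_Ici {μ : ℕ → ProbabilityMeasure ℝ}
    {ν : ProbabilityMeasure ℝ}
    (h : ∀ x, Tendsto (fun n => (μ n : Measure ℝ).real (Set.Ici x)) atTop
      (𝓝 ((ν : Measure ℝ).real (Set.Ici x)))) : Tendsto μ atTop (𝓝 ν) := by
  refine (isPiSystem_Ico (id : ℝ → ℝ) id).tendsto_probabilityMeasure_of_tendsto_of_mem ?_ ?_ ?_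
  · rintro s ⟨a, b, _, rfl⟩
    exact measurableSet_Ico
  · intro u hu x hx
    obtain ⟨ε, hε, hb⟩ := Metric.isOpen_iff.1 hu x hx
    refine ⟨Set.Ico (x - ε / 2) (x + ε / 2), ⟨x - ε / 2, x + ε / 2, by simp only [id]; linarith, rfl⟩,
      Ico_mem_nhds (by linarith) (by linarith), fun y hy => hb ?_⟩
    rw [Metric.mem_ball, Real.dist_eq, abs_lt]
    constructor <;> linarith [hy.1, hy.2]
  · rintro s ⟨a, b, hab, rfl⟩
    have hdiff (ρ : ProbabilityMeasure ℝ) : (ρ : Measure ℝ).real (Set.Ico a b) =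
        (ρ : Measure ℝ).real (Set.Ici a) - (ρ : Measure ℝ).real (Set.Ici b) := by
      have hab' : a ≤ b := le_of_lt hab
      rw [← Set.Ici_sdiff_Ici, measureReal_sdiff (Set.Ici_subset_Ici.2 hab') measurableSet_Ici]
    have h' := (h a).sub (h b)
    simp_rw [← hdiff] at h'
    rw [← NNReal.tendsto_coe]
    exact h'

theorem expMeasure_one_real_Ici (x : ℝ) :
    (expMeasure 1).real (Set.Ici x) = if 0 ≤ x then Real.exp (-x) else 1 := by
  have h0 : expMeasure 1 {x} = 0 := by
    rw [expMeasure, gammaMeasure]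
    exact withDensity_absolutelyContinuous _ _ (by simp)
  have h1 : (expMeasure 1).real (Set.Ici x) = (expMeasure 1).real (Set.Ioi x) := by
    rw [← Set.Ioi_union_left, measureReal_union (by simp) (measurableSet_singleton x),
      measureReal_def (s := {x}), h0]
    simp
  rw [h1, ← Set.compl_Iic, probReal_compl_eq_one_sub measurableSet_Iic, ← cdf_eq_real,
    cdf_expMeasure_eq one_pos]
  split_ifs <;> simp

end Limits

section SumLaw

open Finset

/-- The mean of `exp (i c (V / n - 1 / 2))` for `V` uniform on `{1, …, n}`. -/
noncomputable def uniformCharFun (n : ℕ) (c : ℝ) : ℂ :=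
  (∑ v : Fin n, Complex.exp ((c * ((v + 1) / n - 1 / 2) : ℝ) * Complex.I)) / n

theorem norm_uniformCharFun_le (n : ℕ) (c : ℝ) : ‖uniformCharFun n c‖ ≤ 1 := by
  rw [uniformCharFun, norm_div, Complex.norm_natCast]
  refine div_le_one_of_le₀ ((norm_sum_le_of_le _ fun v _ =>
    (Complex.norm_exp_ofReal_mul_I _).le).trans (by simp)) (by positivity)

theorem norm_sum_le_sub_mul_mean_le {N : ℕ} {e : Fin (N + 1) → ℂ} (he : ∀ v, ‖e v‖ ≤ 1) (s : ℕ)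
    (hs : s ≤ N) :
    ‖∑ v : Fin (N + 1) with v.val ≤ s, e v - (s + 1) * ((∑ v, e v) / (N + 1 : ℕ))‖ ≤
      2 / (N + 1 : ℕ) * ((s + 1) * min ((N + 1 : ℕ) : ℝ) (N - s : ℕ)) := by
  have hle : #{v : Fin (N + 1) | v.val ≤ s} = s + 1 := by
    have : ({v | v.val ≤ s} : Finset (Fin (N + 1))) = Iic ⟨s, Nat.lt_succ_of_le hs⟩ := by
      ext v
      simp [Fin.le_def]
    rw [this, Fin.card_Iic]
  have hgt : #{v : Fin (N + 1) | ¬ v.val ≤ s} = N - s := by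
    have := card_filter_add_card_filter_not (s := (univ : Finset (Fin (N + 1)))) (fun v => v.val ≤ s)
    rw [hle, card_univ, Fintype.card_fin] at this
    omega
  have h1 : ‖∑ v : Fin (N + 1) with v.val ≤ s, e v‖ ≤ (s + 1 : ℕ) :=
    (norm_sum_le_of_le _ fun v _ => he v).trans (by simp [hle])
  have h2 : ‖∑ v : Fin (N + 1) with ¬ v.val ≤ s, e v‖ ≤ (N - s : ℕ) :=
    (norm_sum_le_of_le _ fun v _ => he v).trans (by simp only [sum_const, hgt]; simp)
  rw [← sum_filter_add_sum_filter_not univ (fun v : Fin (N + 1) => v.val ≤ s) e]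
  set A := ∑ v : Fin (N + 1) with v.val ≤ s, e v
  set B := ∑ v : Fin (N + 1) with ¬ v.val ≤ s, e v
  have hN : (0 : ℝ) < (N + 1 : ℕ) := by positivity
  have hN' : ((N + 1 : ℕ) : ℂ) ≠ 0 := by exact_mod_cast hN.ne'
  have hsub : ((N - s : ℕ) : ℂ) = (N + 1 : ℕ) - (s + 1) := by
    push_cast [Nat.cast_sub hs]
    ring
  have heq : A - (s + 1) * ((A + B) / (N + 1 : ℕ)) =
      ((N - s : ℕ) * A - (s + 1 : ℕ) * B) / (N + 1 : ℕ) := by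
    rw [hsub]
    field_simp
    push_cast
    ring
  rw [heq, norm_div, Complex.norm_natCast, min_eq_right (by exact_mod_cast by omega),
    div_mul_eq_mul_div]
  refine div_le_div_of_nonneg_right ?_ hN.le
  calc _ ≤ ((N - s : ℕ) : ℝ) * ‖A‖ + (s + 1 : ℕ) * ‖B‖ := by
        refine (norm_sub_le _ _).trans_eq ?_
        rw [norm_mul, norm_mul, Complex.norm_natCast, Complex.norm_natCast]
    _ ≤ ((N - s : ℕ) : ℝ) * (s + 1 : ℕ) + (s + 1 : ℕ) * (N - s : ℕ) := by gcongr
    _ = _ := by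
        push_cast
        ring

theorem card_filter_val_lt {n k : ℕ} (hk : k ≤ n) :
    #{i : Fin n | (i : ℕ) < k} = k := by
  rw [Fin.card_filter_val_lt, min_eq_right hk]

theorem norm_charFun_sumFirst_sub_le {n k : ℕ} (hn : n ≠ 0) (hk : k ≤ n) (a t : ℝ) :
    ‖charFun ((uniformParking n).map fun f => a * ((sumFirst k f : ℝ) / n - k / 2)) t -
      uniformCharFun n (t * a) ^ k‖ ≤ k * (2 / n * (8 * √n)) := by
  obtain ⟨N, rfl⟩ := Nat.exists_eq_succ_of_ne_zero hn
  let e : Fin (N + 1) → ℂ := fun v =>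
    Complex.exp (((t * a) * ((v + 1) / (N + 1 : ℕ) - 1 / 2) : ℝ) * Complex.I)
  have he (v : Fin (N + 1)) : ‖e v‖ ≤ 1 := (Complex.norm_exp_ofReal_mul_I _).le
  have h := norm_integral_prod_sub_le he (norm_uniformCharFun_le (N + 1) (t * a)) (by positivity)
    (norm_sum_le_sub_mul_mean_le he) {i | (i : ℕ) < k}
  rw [card_filter_val_lt hk] at h
  convert h using 3
  rw [charFun_apply_real, integral_map (measurable_of_finite _).aemeasurable
    (by fun_prop)]
  congr 1
  ext f
  rw [← Complex.exp_sum, ← sum_mul, ← Complex.ofReal_sum]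
  congr 2
  rw [← Complex.ofReal_mul, ← mul_sum, sum_sub_distrib, ← sum_div, sum_const,
    card_filter_val_lt hk]
  simp only [sumFirst, place]
  push_cast
  rw [nsmul_eq_mul]
  ring

theorem sum_sub_half (n : ℕ) (hn : n ≠ 0) :
    ∑ v : Fin n, (((v : ℕ) + 1) / n - 1 / 2 : ℝ) = 1 / 2 := by
  have h (m : ℕ) : ∑ v ∈ range m, ((v : ℝ) + 1) = m * (m + 1) / 2 := by
    induction m with
    | zero => simp
    | succ m ih =>
      rw [sum_range_succ, ih]
      push_cast
      ring
  rw [Fin.sum_univ_eq_sum_range (fun v : ℕ => ((v + 1) / n - 1 / 2 : ℝ)), sum_sub_distrib,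
    ← sum_div, h]
  simp
  field_simp
  ring

theorem sum_sub_half_sq (n : ℕ) (hn : n ≠ 0) :
    ∑ v : Fin n, (((v : ℕ) + 1) / n - 1 / 2 : ℝ) ^ 2 = n / 12 + 1 / (6 * n) := by
  have hn' : (n : ℝ) ≠ 0 := by exact_mod_cast hn
  have h (m : ℕ) : ∑ v ∈ range m, (((v : ℝ) + 1) / n - 1 / 2) ^ 2 =
      m * (m + 1) * (2 * m + 1) / (6 * (n : ℝ) ^ 2) - m * (m + 1) / (2 * n) + m / 4 := by
    induction m with
    | zero => simp
    | succ m ih =>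
      rw [sum_range_succ, ih]
      push_cast
      field_simp
      ring
  rw [Fin.sum_univ_eq_sum_range (fun v : ℕ => ((v + 1) / n - 1 / 2 : ℝ) ^ 2), h]
  field_simp
  ring

theorem norm_exp_sub_taylor_le {x : ℝ} (hx : |x| ≤ 1) :
    ‖Complex.exp (x * Complex.I) - (1 + x * Complex.I - (x ^ 2 / 2 : ℝ))‖ ≤ |x| ^ 3 := by
  have hnorm : ‖(x * Complex.I : ℂ)‖ = |x| := by simp
  have h := Complex.exp_bound (x := x * Complex.I) (by rwa [hnorm]) (n := 3) (by norm_num)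
  rw [hnorm] at h
  simp only [sum_range_succ, sum_range_zero] at h
  norm_num [Nat.factorial, mul_pow] at h
  push_cast
  refine le_trans (le_of_eq_of_le ?_ h) ?_
  · congr 1
    ring
  · nlinarith [pow_nonneg (abs_nonneg x) 3]

theorem norm_uniformCharFun_sub_le {n : ℕ} (hn : n ≠ 0) {c : ℝ} (hc : |c| ≤ 1) :
    ‖uniformCharFun n c - 1 -
      (c / (2 * n) * Complex.I - (c ^ 2 / 2 * (1 / 12 + 1 / (6 * n ^ 2)) : ℝ))‖ ≤ |c| ^ 3 := by
  have hn0 : (0 : ℝ) < n := by positivity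
  have hnc : (n : ℂ) ≠ 0 := by exact_mod_cast hn
  set y : Fin n → ℝ := fun v => ((v : ℕ) + 1) / n - 1 / 2 with hy
  have hy1 (v : Fin n) : |y v| ≤ 1 := by
    have h1 : (((v : ℕ) : ℝ) + 1) / n ≤ 1 := by
      rw [div_le_one hn0]
      exact_mod_cast v.2
    have h2 : 0 ≤ (((v : ℕ) : ℝ) + 1) / n := by positivity
    rw [abs_le]
    constructor <;> simp only [hy] <;> linarith
  have hterm (v : Fin n) : ‖Complex.exp ((c * y v : ℝ) * Complex.I) -
      (1 + (c * y v : ℝ) * Complex.I - ((c * y v) ^ 2 / 2 : ℝ))‖ ≤ |c| ^ 3 := by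
    have hle : |c * y v| ≤ |c| := by
      rw [abs_mul]
      exact mul_le_of_le_one_right (abs_nonneg _) (hy1 v)
    exact (norm_exp_sub_taylor_le (hle.trans hc)).trans (pow_le_pow_left₀ (abs_nonneg _) hle 3)
  have hsum := norm_sum_le_of_le univ fun v _ => hterm v
  have hs1 := sum_sub_half n hn
  have hs2 := sum_sub_half_sq n hn
  have hU : ∑ v : Fin n, Complex.exp ((c * y v : ℝ) * Complex.I) = n * uniformCharFun n c := by
    rw [uniformCharFun, mul_div_cancel₀ _ hnc]
  have heq : ∑ v : Fin n, (Complex.exp ((c * y v : ℝ) * Complex.I) -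
      (1 + (c * y v : ℝ) * Complex.I - ((c * y v) ^ 2 / 2 : ℝ))) =
      n * (uniformCharFun n c - 1 -
        (c / (2 * n) * Complex.I - (c ^ 2 / 2 * (1 / 12 + 1 / (6 * n ^ 2)) : ℝ))) := by
    simp_rw [sum_sub_distrib, sum_add_distrib, ← sum_mul, hU, ← Complex.ofReal_sum, mul_pow,
      mul_div_right_comm, ← mul_sum, hy, hs1, hs2]
    simp only [sum_const, card_univ, Fintype.card_fin, nsmul_eq_mul, mul_one]
    push_cast
    field_simp
    ring
  rw [heq, norm_mul, Complex.norm_natCast] at hsum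
  simp only [sum_const, card_univ, Fintype.card_fin, nsmul_eq_mul] at hsum
  exact le_of_mul_le_mul_left hsum hn0

end SumLaw

section MaxLaw

open Finset

theorem norm_sum_indicator_sub_le {N m : ℕ} (hm : m ≤ N + 1) (s : ℕ) (hs : s ≤ N) :
    ‖∑ v : Fin (N + 1) with v.val ≤ s, (if (v : ℕ) < m then 1 else 0 : ℂ) -
      (s + 1) * (m / (N + 1 : ℕ))‖ ≤
      1 / (N + 1 : ℕ) * ((s + 1) * min ((N + 1 - m : ℕ) : ℝ) (N - s : ℕ)) := by
  have hcard : ∑ v : Fin (N + 1) with v.val ≤ s, (if (v : ℕ) < m then 1 else 0 : ℂ) =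
      (min (s + 1) m : ℕ) := by
    rw [sum_boole, filter_filter]
    congr 1
    have : #{v : Fin (N + 1) | (v : ℕ) < min (s + 1) m} = min (s + 1) m := by
      rw [Fin.card_filter_val_lt]
      omega
    rw [← this]
    congr 1
    ext v
    simp only [mem_filter, mem_univ, true_and]
    omega
  have hN : (0 : ℝ) < (N + 1 : ℕ) := by positivity
  have hreal (q : ℕ) : (q : ℂ) - (s + 1) * (m / (N + 1 : ℕ)) =
      ((q - (s + 1) * (m / (N + 1 : ℕ)) : ℝ) : ℂ) := by
    push_cast
    ring
  rw [hcard, hreal, Complex.norm_real, Real.norm_eq_abs]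
  have hNs : ((N - s : ℕ) : ℝ) = (N + 1 : ℕ) - (s + 1) := by
    push_cast [Nat.cast_sub hs]
    ring
  have hNm : ((N + 1 - m : ℕ) : ℝ) = (N + 1 : ℕ) - m := by
    rw [Nat.cast_sub hm]
  rw [hNs, hNm]
  have hmN : (m : ℝ) ≤ (N + 1 : ℕ) := by exact_mod_cast hm
  have hsN : ((s : ℝ) + 1) ≤ (N + 1 : ℕ) := by exact_mod_cast Nat.succ_le_succ hs
  generalize ((N + 1 : ℕ) : ℝ) = n at *
  rcases le_total (s + 1) m with h | h
  · have h' : (s + 1 : ℝ) ≤ m := by exact_mod_cast h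
    rw [min_eq_left h, min_eq_left (by linarith)]
    push_cast
    have : (s + 1 : ℝ) - (s + 1) * (m / n) = 1 / n * ((s + 1) * (n - m)) := by
      field_simp
    rw [this, abs_of_nonneg]
    have : 0 ≤ n - m := by linarith
    positivity
  · have h' : (m : ℝ) ≤ s + 1 := by exact_mod_cast h
    rw [min_eq_right h, min_eq_right (by linarith)]
    have : (m : ℝ) - (s + 1) * (m / n) = 1 / n * (m * (n - (s + 1))) := by
      field_simp
    have h0 : 0 ≤ n - (s + 1) := by linarith
    rw [this, abs_of_nonneg (by positivity)]
    gcongr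

theorem abs_real_maxFirst_le_sub_le {n k m : ℕ} (hn : n ≠ 0) (hk : k ≤ n) (hm : m ≤ n) :
    |(uniformParking n).real {f | maxFirst k f ≤ m} - (m / n : ℝ) ^ k| ≤
      k * (1 / n * (8 * √((n - m : ℕ) : ℝ))) := by
  obtain ⟨N, rfl⟩ := Nat.exists_eq_succ_of_ne_zero hn
  let e : Fin (N + 1) → ℂ := fun v => if (v : ℕ) < m then 1 else 0
  have he (v : Fin (N + 1)) : ‖e v‖ ≤ 1 := by
    simp only [e]
    split_ifs <;> simp
  have hφ : ‖(m / (N + 1 : ℕ) : ℂ)‖ ≤ 1 := by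
    rw [norm_div, Complex.norm_natCast, Complex.norm_natCast]
    exact div_le_one_of_le₀ (by exact_mod_cast hm) (by positivity)
  have h := norm_integral_prod_sub_le he hφ (by positivity) (norm_sum_indicator_sub_le hm)
    {i | (i : ℕ) < k}
  rw [card_filter_val_lt hk] at h
  have hprod (f : Fin (N + 1) → Fin (N + 1)) : ∏ l : Fin (N + 1) with l.val < k, e (f l) =
      ({f | maxFirst k f ≤ m} : Set (Fin (N + 1) → Fin (N + 1))).indicator 1 f := by
    simp only [e, prod_boole, Set.indicator_apply, Set.mem_ofPred_eq, maxFirst, place,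
      Finset.sup_le_iff, Pi.one_apply, Nat.succ_le_iff]
    congr
  simp_rw [hprod] at h
  rw [integral_indicator (Set.toFinite _).measurableSet] at h
  simp only [Pi.one_apply, setIntegral_const, Complex.real_smul, mul_one] at h
  rw [← Real.norm_eq_abs, ← Complex.norm_real]
  push_cast at h ⊢
  exact h

end MaxLaw

section Convergence

open Topology

theorem tendsto_charFun_sumFirst {k : ℕ → ℕ} (hk : Tendsto k atTop atTop)
    (hko : (fun n => (k n : ℝ)) =o[atTop] fun n => √(n : ℝ)) (t : ℝ) :
    Tendsto (fun n => charFun ((uniformParking n).map fun f =>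
      √(12 / (k n : ℝ)) * ((sumFirst (k n) f : ℝ) / n - k n / 2)) t) atTop
      (𝓝 (Complex.exp (-t ^ 2 / 2))) := by
  have hle : ∀ᶠ n in atTop, k n ≤ n := by
    filter_upwards [hko.bound one_pos, eventually_ge_atTop 1] with n h hn
    have hn' : (1 : ℝ) ≤ n := by exact_mod_cast hn
    rw [Real.norm_of_nonneg (by positivity), Real.norm_of_nonneg (by positivity), one_mul] at h
    have h2 : √(n : ℝ) ≤ n := Real.sqrt_le_iff.2 ⟨by positivity, by nlinarith⟩
    exact_mod_cast h.trans h2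
  set c : ℕ → ℝ := fun n => t * √(12 / (k n : ℝ)) with hc
  have hc0 : Tendsto c atTop (𝓝 0) := by
    have h1 : Tendsto (fun n => 12 / (k n : ℝ)) atTop (𝓝 0) :=
      (tendsto_const_div_atTop_nhds_zero_nat 12).comp hk
    have h2 := ((Real.continuous_sqrt.tendsto 0).comp h1).const_mul t
    simpa [hc] using h2
  have hcabs : Tendsto (fun n => |c n|) atTop (𝓝 0) := by simpa using hc0.abs
  have hpow : Tendsto (fun n => uniformCharFun n (c n) ^ k n) atTop
      (𝓝 (Complex.exp (-t ^ 2 / 2))) := by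
    have hmul : Tendsto (fun n => (k n : ℂ) * (uniformCharFun n (c n) - 1)) atTop
        (𝓝 (-t ^ 2 / 2)) := by
      rw [tendsto_iff_norm_sub_tendsto_zero]
      have hbound : Tendsto (fun n : ℕ => 12 * t ^ 2 * |c n| + |c n| + t ^ 2 * (1 / (n : ℝ)))
          atTop (𝓝 0) := by
        have := ((hcabs.const_mul (12 * t ^ 2)).add hcabs).add
          (tendsto_one_div_atTop_nhds_zero_nat.const_mul (t ^ 2))
        simpa using this
      refine squeeze_zero' (Eventually.of_forall fun _ => norm_nonneg _) ?_ hbound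
      filter_upwards [hle, eventually_ge_atTop 1, hk.eventually_ge_atTop 1,
        hcabs.eventually_le_const one_pos] with n hkn hn hk1 hc1
      have hn' : (1 : ℝ) ≤ n := by exact_mod_cast hn
      have hk' : (1 : ℝ) ≤ k n := by exact_mod_cast hk1
      have hkn' : (k n : ℝ) ≤ n := by exact_mod_cast hkn
      have hkc : k n * c n ^ 2 = 12 * t ^ 2 := by
        simp only [hc]
        rw [mul_pow, Real.sq_sqrt (by positivity)]
        field_simp
      have h1 := norm_uniformCharFun_sub_le (by omega : n ≠ 0) hc1
      set D := uniformCharFun n (c n) - 1 -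
        (c n / (2 * n) * Complex.I - (c n ^ 2 / 2 * (1 / 12 + 1 / (6 * n ^ 2)) : ℝ)) with hD
      have heq : (k n : ℂ) * (uniformCharFun n (c n) - 1) - -t ^ 2 / 2 =
          k n * D + (k n / (2 * n) * c n : ℝ) * Complex.I - (t ^ 2 / n ^ 2 : ℝ) := by
        have hkc' : (k n : ℂ) * (c n : ℂ) ^ 2 = 12 * t ^ 2 := by exact_mod_cast hkc
        rw [hD]
        push_cast
        simp only [div_eq_mul_inv, mul_inv]
        linear_combination -(1 / 24 + 1 / 12 * ((n : ℂ) ^ 2)⁻¹) * hkc'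
      rw [heq]
      have ha : ‖(k n : ℂ) * D‖ ≤ 12 * t ^ 2 * |c n| := by
        rw [norm_mul, Complex.norm_natCast]
        calc (k n : ℝ) * ‖D‖ ≤ k n * |c n| ^ 3 := by gcongr
          _ = (k n * |c n| ^ 2) * |c n| := by ring
          _ = _ := by rw [sq_abs, hkc]
      have hb : ‖((k n / (2 * n) * c n : ℝ) : ℂ) * Complex.I‖ ≤ |c n| := by
        rw [norm_mul, Complex.norm_I, mul_one, Complex.norm_real, Real.norm_eq_abs, abs_mul,
          abs_of_nonneg (by positivity)]
        refine mul_le_of_le_one_left (abs_nonneg _) ?_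
        rw [div_le_one (by positivity)]
        linarith
      have hd : ‖((t ^ 2 / n ^ 2 : ℝ) : ℂ)‖ ≤ t ^ 2 * (1 / n) := by
        rw [Complex.norm_real, Real.norm_of_nonneg (by positivity), div_eq_mul_one_div]
        gcongr
        nlinarith
      exact (norm_sub_le _ _).trans (add_le_add ((norm_add_le _ _).trans (add_le_add ha hb)) hd)
    simpa using Complex.tendsto_one_add_pow_of_tendsto_mul hk hmul
  have herr : Tendsto (fun n : ℕ => 16 * (k n / √(n : ℝ))) atTop (𝓝 0) := by
    simpa using hko.tendsto_div_nhds_zero.const_mul 16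
  have hdiff : Tendsto (fun n => charFun ((uniformParking n).map fun f =>
      √(12 / (k n : ℝ)) * ((sumFirst (k n) f : ℝ) / n - k n / 2)) t -
        uniformCharFun n (c n) ^ k n) atTop (𝓝 0) := by
    refine squeeze_zero_norm' ?_ herr
    filter_upwards [hle, eventually_ge_atTop 1] with n hkn hn
    refine (norm_charFun_sumFirst_sub_le (by omega) hkn _ t).trans_eq ?_
    have hn0 : (0 : ℝ) < n := by exact_mod_cast hn
    have hsq := Real.mul_self_sqrt hn0.le
    have hs : 0 < √(n : ℝ) := Real.sqrt_pos.2 hn0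
    nth_rw 1 [← hsq]
    field_simp
    ring
  simpa using hdiff.add hpow

theorem le_scaled_maxFirst_iff {n k : ℕ} (hn : n ≠ 0) (hk : k ≠ 0) {x : ℝ} (hx : x ≤ k)
    (f : Fin n → Fin n) :
    x ≤ k * (1 - 1 / (n : ℝ) * maxFirst k f) ↔ maxFirst k f ≤ ⌊(n * (1 - x / k) : ℝ)⌋₊ := by
  have hn0 : (0 : ℝ) < n := by positivity
  have hk0 : (0 : ℝ) < k := by positivity
  have hxk : x / k ≤ 1 := (div_le_one hk0).2 hx
  rw [Nat.le_floor_iff (mul_nonneg hn0.le (by linarith)), ← div_le_iff₀' hk0, ← div_le_iff₀' hn0,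
    one_div_mul_eq_div]
  constructor <;> intro h <;> linarith

theorem maxFirst_le {n : ℕ} (k : ℕ) (f : Fin n → Fin n) : maxFirst k f ≤ n :=
  Finset.sup_le fun i _ => (f i).2

theorem tendsto_real_scaled_maxFirst {k : ℕ → ℕ} (hk : Tendsto k atTop atTop)
    (hko : (fun n => (k n : ℝ)) =o[atTop] fun n => (n : ℝ)) (x : ℝ) :
    Tendsto (fun n => (uniformParking n).real
      {f | x ≤ k n * (1 - 1 / (n : ℝ) * maxFirst (k n) f)}) atTop
      (𝓝 (if 0 ≤ x then Real.exp (-x) else 1)) := by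
  split_ifs with hx
  · have hle : ∀ᶠ n in atTop, k n ≤ n := by
      filter_upwards [hko.bound one_pos] with n h
      simpa using h
    have hr : Tendsto (fun n => (k n / n : ℝ)) atTop (𝓝 0) := hko.tendsto_div_nhds_zero
    set m : ℕ → ℕ := fun n => ⌊(n * (1 - x / k n) : ℝ)⌋₊ with hm
    have hm_bounds : ∀ᶠ n in atTop, m n ≤ n ∧ (m n : ℝ) ≤ n - n * x / k n ∧
        n - n * x / k n - 1 ≤ m n := by
      filter_upwards [hk.eventually_ge_atTop (max 1 ⌈x⌉₊)] with n hkn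
      have hk1 : (1 : ℝ) ≤ k n := by exact_mod_cast (le_max_left _ _).trans hkn
      have hkx : x ≤ k n := (Nat.le_ceil x).trans (by exact_mod_cast (le_max_right _ _).trans hkn)
      have hxk : x / k n ≤ 1 := (div_le_one (by linarith)).2 hkx
      have hxk0 : 0 ≤ x / k n := by positivity
      have hy : 0 ≤ (n : ℝ) * (1 - x / k n) := mul_nonneg (by positivity) (by linarith)
      have h1 : (m n : ℝ) ≤ n * (1 - x / k n) := Nat.floor_le hy
      have h2 : (n : ℝ) * (1 - x / k n) < m n + 1 := Nat.lt_floor_add_one _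
      have h3 : (n : ℝ) * (1 - x / k n) = n - n * x / k n := by ring
      refine ⟨?_, by linarith, by linarith⟩
      have : (m n : ℝ) ≤ n := h1.trans (mul_le_of_le_one_right (by positivity) (by linarith))
      exact_mod_cast this
    have hpow : Tendsto (fun n => (m n / n : ℝ) ^ k n) atTop (𝓝 (Real.exp (-x))) := by
      have hmul : Tendsto (fun n => (k n : ℝ) * (m n / n - 1)) atTop (𝓝 (-x)) := by
        have hlow : Tendsto (fun n => -x - (k n / n : ℝ)) atTop (𝓝 (-x)) := by
          simpa using hr.const_sub (-x)
        refine tendsto_of_tendsto_of_tendsto_of_le_of_le' hlow tendsto_const_nhds ?_ ?_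
        · filter_upwards [hm_bounds, eventually_ge_atTop 1, hk.eventually_ge_atTop 1] with n h hn hk1
          have hn0 : (0 : ℝ) < n := by exact_mod_cast hn
          have hk0 : (0 : ℝ) < k n := by exact_mod_cast hk1
          calc -x - (k n / n : ℝ) = k n * ((n - n * x / k n - 1) / n - 1) := by field_simp; ring
            _ ≤ _ := by gcongr; exact h.2.2
        · filter_upwards [hm_bounds, eventually_ge_atTop 1, hk.eventually_ge_atTop 1] with n h hn hk1
          have hn0 : (0 : ℝ) < n := by exact_mod_cast hn
          have hk0 : (0 : ℝ) < k n := by exact_mod_cast hk1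
          calc _ ≤ (k n : ℝ) * ((n - n * x / k n) / n - 1) := by gcongr; exact h.2.1
            _ = -x := by field_simp; ring
      have hmulC : Tendsto (fun n => (k n : ℂ) * ((m n / n - 1 : ℝ) : ℂ)) atTop
          (𝓝 ((-x : ℝ) : ℂ)) := by
        have := (Complex.continuous_ofReal.tendsto (-x)).comp hmul
        refine this.congr fun n => ?_
        simp
      have := (Complex.continuous_re.tendsto _).comp
        (Complex.tendsto_one_add_pow_of_tendsto_mul hk hmulC)
      rw [← Complex.ofReal_exp, Complex.ofReal_re] at this
      refine this.congr fun n => ?_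
      rw [Function.comp_apply, ← Complex.ofReal_one, ← Complex.ofReal_add, ← Complex.ofReal_pow,
        Complex.ofReal_re]
      congr 1
      ring
    have herr : Tendsto (fun n => 8 * √((k n / n : ℝ) * x + (k n / n : ℝ) ^ 2)) atTop (𝓝 0) := by
      have h1 := (hr.mul_const x).add (hr.pow 2)
      have h2 := ((Real.continuous_sqrt.tendsto _).comp h1).const_mul 8
      simpa using h2
    have hdiff : Tendsto (fun n => (uniformParking n).real
        {f | x ≤ k n * (1 - 1 / (n : ℝ) * maxFirst (k n) f)} - (m n / n : ℝ) ^ k n) atTop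
        (𝓝 0) := by
      refine squeeze_zero_norm' ?_ herr
      filter_upwards [hle, hm_bounds, eventually_ge_atTop 1,
        hk.eventually_ge_atTop (max 1 ⌈x⌉₊)] with n hkn hmn hn hk1
      have hn0 : (0 : ℝ) < n := by exact_mod_cast hn
      have hk0 : 0 < k n := (le_max_left _ _).trans hk1
      have hk0' : (0 : ℝ) < k n := by exact_mod_cast hk0
      have hkx : x ≤ k n := (Nat.le_ceil x).trans (by exact_mod_cast (le_max_right _ _).trans hk1)
      simp_rw [le_scaled_maxFirst_iff (by omega : n ≠ 0) hk0.ne' hkx]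
      refine (abs_real_maxFirst_le_sub_le (by omega) hkn hmn.1).trans ?_
      have hsub : ((n - m n : ℕ) : ℝ) ≤ n * x / k n + 1 := by
        rw [Nat.cast_sub hmn.1]
        linarith [hmn.2.2]
      calc (k n : ℝ) * (1 / n * (8 * √((n - m n : ℕ) : ℝ)))
          = 8 * ((k n / n) * √((n - m n : ℕ) : ℝ)) := by ring
        _ ≤ 8 * ((k n / n) * √(n * x / k n + 1)) := by gcongr
        _ = 8 * √((k n / n) ^ 2 * (n * x / k n + 1)) := by
            rw [Real.sqrt_mul (by positivity), Real.sqrt_sq (by positivity)]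
        _ = _ := by
            congr 2
            field_simp
    simpa using hdiff.add hpow
  · refine tendsto_const_nhds.congr' ?_
    filter_upwards [eventually_ge_atTop 1] with n hn
    have hn0 : (0 : ℝ) < n := by exact_mod_cast hn
    have : {f : Fin n → Fin n | x ≤ k n * (1 - 1 / (n : ℝ) * maxFirst (k n) f)} = Set.univ := by
      refine Set.eq_univ_of_forall fun f => ?_
      have h1 : (maxFirst (k n) f : ℝ) ≤ n := by exact_mod_cast maxFirst_le _ f
      have h2 : 1 / (n : ℝ) * maxFirst (k n) f ≤ 1 := by
        rw [one_div_mul_eq_div]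
        exact (div_le_one hn0).2 h1
      exact (not_le.1 hx).le.trans (mul_nonneg (Nat.cast_nonneg _) (by linarith))
    rw [this, probReal_univ]

end Convergence

theorem corollary2 {Ω : ℕ → Type*} [∀ n, MeasurableSpace (Ω n)]
    (P : ∀ n, Measure (Ω n)) [∀ n, IsProbabilityMeasure (P n)]
    (π : ∀ n, Ω n → Fin n → Fin n)
    (hπ : ∀ n, HasLaw (π n) (uniformParking n) (P n))
    (k : ℕ → ℕ) (hk : Tendsto k atTop atTop) :
    ((fun n => (k n : ℝ)) =o[atTop] (fun n => Real.sqrt (n : ℝ)) →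
      TendstoInDistribution
        (fun n ω => Real.sqrt (12 / (k n : ℝ)) *
          ((sumFirst (k n) (π n ω) : ℝ) / (n : ℝ) - (k n : ℝ) / 2))
        atTop (id : ℝ → ℝ) P (gaussianReal 0 1)) ∧
    ((fun n => (k n : ℝ)) =o[atTop] (fun n => (n : ℝ)) →
      TendstoInDistribution
        (fun n ω => (k n : ℝ) * (1 - 1 / (n : ℝ) * (maxFirst (k n) (π n ω) : ℝ)))
        atTop (id : ℝ → ℝ) P (expMeasure 1)) := by
  have hmeas {n : ℕ} (F : (Fin n → Fin n) → ℝ) : Measurable F := measurable_of_finite F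
  have hmap (n : ℕ) (F : (Fin n → Fin n) → ℝ) :
      (P n).map (fun ω => F (π n ω)) = (uniformParking n).map F := by
    rw [← (hπ n).map_eq, AEMeasurable.map_map_of_aemeasurable (hmeas F).aemeasurable
      (hπ n).aemeasurable]
    rfl
  have hae (n : ℕ) (F : (Fin n → Fin n) → ℝ) : AEMeasurable (fun ω => F (π n ω)) (P n) :=
    (hmeas F).comp_aemeasurable (hπ n).aemeasurable
  refine ⟨fun hko => ⟨fun n => hae n fun f => Real.sqrt (12 / (k n : ℝ)) *
      ((sumFirst (k n) f : ℝ) / (n : ℝ) - (k n : ℝ) / 2), aemeasurable_id, ?_⟩,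
    fun hko => ⟨fun n => hae n fun f => (k n : ℝ) *
      (1 - 1 / (n : ℝ) * (maxFirst (k n) f : ℝ)), aemeasurable_id, ?_⟩⟩
  · refine MeasureTheory.ProbabilityMeasure.tendsto_iff_tendsto_charFun.2 fun t => ?_
    simp only [ProbabilityMeasure.coe_mk, Measure.map_id, charFun_gaussianReal]
    have h := tendsto_charFun_sumFirst hk hko t
    simp_rw [← hmap] at h
    simpa [neg_div] using h
  · refine ProbabilityMeasure.tendsto_of_tendsto_real_Ici fun x => ?_
    simp only [ProbabilityMeasure.coe_mk, Measure.map_id, expMeasure_one_real_Ici]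
    refine (tendsto_real_scaled_maxFirst hk hko x).congr fun n => ?_
    rw [hmap n fun f => (k n : ℝ) * (1 - 1 / (n : ℝ) * (maxFirst (k n) f : ℝ)),
      map_measureReal_apply (hmeas _) measurableSet_Ici]
    rfl
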